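/- Let $\mathbf P$ be a countable set of propositional atoms, given with a numbering $\mathbf P\to\mathbb N$ that is injective and has a primitive recursive range (for instance $\mathbf P=\mathbb N$ or $\mathbf P$ finite). The formulas of definable sabotage modal logic S$_d$ML are given by $$\varphi::=p\mid\neg\varphi\mid(\varphi\land\varphi)\mid\Box\varphi\mid[-\varphi]\varphi\qquad(p\in\mathbf P),$$ with $\varphi\to\psi:=\neg(\varphi\land\neg\psi)$. They are evaluated at points $w$ of models $\mathcal M=\langle W,R,V\rangle$, where $W\neq\emptyset$, $R\subseteq W^2$ and $V:\mathbf P\to 2^W$: atoms, $\neg$ and $\land$ are interpreted as usual; $\mathcal M,w\vDash\Box\varphi$ iff $\mathcal M,v\vDash\varphi$ for all $v$ with $Rwv$; and $\mathcal M,w\vDash[-\varphi]\psi$ iff $\mathcal M|_{\langle w,\varphi\rangle},w\vDash\psi$, where $\mathcal M|_{\langle w,\varphi\rangle}=\langle W,R\setminus(\{w\}\times\{v:\mathcal M,v\vDash\varphi\}),V\rangle$. A formula is valid if it is true at every point of every model. Formulas are identified with their Gödel numbers when we speak of decidable or recursively enumerable sets of formulas. Then S$_d$ML is recursively axiomatizable: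 there is a decidable set of formulas (axioms) such that the valid formulas are exactly those derivable from the axioms by modus ponens. In particular, the set of valid formulas is recursively enumerable. -/

import Mathlib

universe u v

namespace SdML

/-- The language of definable sabotage modal logic over the set `P` of propositional atoms:
`sab φ ψ` is the formula `[-φ]ψ`. -/
inductive Formula (P : Type u) : Type u where
  | atom : P → Formula P
  | neg : Formula P → Formula P
  | and : Formula P → Formula P → Formula P
  | box : Formula P → Formula P
  | sab : Formula P → Formula P → Formula P

namespace Formula

variable {P : Type u}

/-- Implication, as the usual abbreviation `¬(φ ∧ ¬ψ)`. -/
def imp (φ ψ : Formula P) : Formula P := neg (and φ (neg ψ))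

/-- The Gödel number of a formula, built from the numbers of the atoms with the standard
pairing function on the natural numbers. -/
def code [Encodable P] : Formula P → ℕ
  | atom p => Nat.pair 0 (Encodable.encode p)
  | neg φ => Nat.pair 1 φ.code
  | and φ ψ => Nat.pair 2 (Nat.pair φ.code ψ.code)
  | box φ => Nat.pair 3 φ.code
  | sab φ ψ => Nat.pair 4 (Nat.pair φ.code ψ.code)

theorem code_injective [Encodable P] : Function.Injective (code : Formula P → ℕ) := by
  intro φ
  induction φ with
  | atom p => intro χ h; cases χ <;> simp_all [code, Nat.pair_eq_pair]
  | neg φ ih =>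
    intro χ h
    cases χ <;> simp [code, Nat.pair_eq_pair] at h
    rw [ih h]
  | and φ ψ ih1 ih2 =>
    intro χ h
    cases χ <;> simp [code, Nat.pair_eq_pair] at h
    rw [ih1 h.1, ih2 h.2]
  | box φ ih =>
    intro χ h
    cases χ <;> simp [code, Nat.pair_eq_pair] at h
    rw [ih h]
  | sab φ ψ ih1 ih2 =>
    intro χ h
    cases χ <;> simp [code, Nat.pair_eq_pair] at h
    rw [ih1 h.1, ih2 h.2]

end Formula

/-- A relational model with domain `W`: an accessibility relation and a valuation. -/
structure Model (P : Type u) (W : Type v) where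
  R : W → W → Prop
  V : P → Set W

/-- Delete all links from `w` to points of `X`. -/
def Model.delete {P : Type u} {W : Type v} (M : Model P W) (w : W) (X : Set W) : Model P W where
  R := fun a b => M.R a b ∧ ¬ (a = w ∧ b ∈ X)
  V := M.V

/-- Truth of a formula in a model at a point. -/
def Formula.Sat {P : Type u} {W : Type v} : Formula P → Model P W → W → Prop
  | .atom p, M, w => w ∈ M.V p
  | .neg φ, M, w => ¬ φ.Sat M w
  | .and φ ψ, M, w => φ.Sat M w ∧ ψ.Sat M w
  | .box φ, M, w => ∀ x : W, M.R w x → φ.Sat M x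
  | .sab φ ψ, M, w => ψ.Sat (M.delete w {x | φ.Sat M x}) w

/-- The set of formulas that are true at every point of every model (with non-empty domain). -/
def validities (P : Type u) : Set (Formula P) :=
  {φ | ∀ (W : Type v) [Nonempty W] (M : Model P W) (w : W), φ.Sat M w}

/-- Derivability from a set of axioms, with modus ponens as the only rule. -/
inductive Derivable {P : Type u} (Ax : Set (Formula P)) : Formula P → Prop where
  | ax {φ : Formula P} : φ ∈ Ax → Derivable Ax φ
  | mp {φ ψ : Formula P} : Derivable Ax (φ.imp ψ) → Derivable Ax φ → Derivable Ax ψ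

/-- The set of formulas `L` is recursively axiomatizable: it consists exactly of the formulas
derivable by modus ponens from some decidable set of axioms. -/
def RecursivelyAxiomatizable {P : Type u} [Primcodable P] (L : Set (Formula P)) : Prop :=
  ∃ Ax : Set (Formula P),
    ComputablePred (fun n : ℕ => n ∈ Formula.code '' Ax) ∧
    ∀ φ : Formula P, φ ∈ L ↔ Derivable Ax φ

end SdML

namespace SdML

/-! Validity is shown to be entailment from a primitive recursive set of propositional clauses. A
deletion is determined by the world where it happens and the formula that defines it, so over worlds
numbered by `ℕ` a finite list of deletions has a numerical code `D`, and truth and links after `D`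
become propositional variables. The truth conditions are finite clauses, except that the failure of
a box needs a witness among infinitely many worlds. A Löwenheim–Skolem argument with bookkeeping
(`exists_numbering`) places a witness below a bound computed from the formula, `D` and the world, so
that one finite clause suffices.

Models thus yield valuations satisfying the clauses (`exists_valuation`), and such valuations yield
models on a copy of `ℕ` (`sat_iff_tVar`); together these give `mem_code_image_validities_iff`. By
compactness (`exists_sat_iff_forall_partialSat`) unsatisfiability shows at a finite stage, so the
codes of validities are recursively enumerable. Craig's trick turns the enumeration into a decidable
set of axioms. -/

/-! ### Propositional compactness by bounded search -/

/-- The literal `l` is true under `z`, or its variable is not below `m`. -/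
def LitHolds (m : ℕ) (z : ℕ → Bool) (l : ℕ × Bool) : Prop :=
  m ≤ l.1 ∨ z l.1 = l.2

/-- The clauses `cl c` with `c < m` and the clause `q` hold under `z`, as far as the variables
below `m` can tell. -/
def PartialSat (cl : ℕ → List (List (ℕ × Bool))) (q : List (ℕ × Bool)) (m : ℕ)
    (z : ℕ → Bool) : Prop :=
  (∀ c < m, ∀ C ∈ cl c, ∃ l ∈ C, LitHolds m z l) ∧ ∃ l ∈ q, LitHolds m z l

theorem LitHolds.anti {m m' : ℕ} (h : m ≤ m') {z : ℕ → Bool} {l : ℕ × Bool}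
    (hl : LitHolds m' z l) : LitHolds m z l :=
  hl.imp_left h.trans

/-- A later stage looks at more clauses and counts fewer literals as true by default. The stages
therefore form the decreasing sequence of closed sets that compactness needs. -/
theorem PartialSat.anti {cl : ℕ → List (List (ℕ × Bool))} {q : List (ℕ × Bool)} {m m' : ℕ}
    (h : m ≤ m') {z : ℕ → Bool} (hz : PartialSat cl q m' z) : PartialSat cl q m z := by
  refine ⟨fun c hc C hC => ?_, ?_⟩
  · obtain ⟨l, hl, h'⟩ := hz.1 c (hc.trans_le h) C hC
    exact ⟨l, hl, h'.anti h⟩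
  · obtain ⟨l, hl, h'⟩ := hz.2
    exact ⟨l, hl, h'.anti h⟩

theorem isClosed_litHolds (m : ℕ) (l : ℕ × Bool) : IsClosed {z | LitHolds m z l} := by
  unfold LitHolds
  rw [Set.ofPred_or]
  exact isClosed_const.union (isClosed_eq (continuous_apply _) continuous_const)

theorem isClosed_exists_litHolds (m : ℕ) (C : List (ℕ × Bool)) :
    IsClosed {z | ∃ l ∈ C, LitHolds m z l} := by
  have : {z | ∃ l ∈ C, LitHolds m z l} = ⋃ l ∈ {l | l ∈ C}, {z | LitHolds m z l} := by
    ext z; simp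
  rw [this]
  exact (List.finite_toSet C).isClosed_biUnion fun l _ => isClosed_litHolds m l

theorem isClosed_partialSat (cl : ℕ → List (List (ℕ × Bool))) (q : List (ℕ × Bool)) (m : ℕ) :
    IsClosed {z | PartialSat cl q m z} := by
  have h : {z : ℕ → Bool | ∀ c < m, ∀ C ∈ cl c, ∃ l ∈ C, LitHolds m z l} =
      ⋂ (c) (_ : c < m) (C) (_ : C ∈ cl c), {z | ∃ l ∈ C, LitHolds m z l} := by
    ext z; simp
  have h' : IsClosed {z : ℕ → Bool | ∀ c < m, ∀ C ∈ cl c, ∃ l ∈ C, LitHolds m z l} := by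
    rw [h]
    exact isClosed_iInter fun c => isClosed_iInter fun _ => isClosed_iInter fun C =>
      isClosed_iInter fun _ => isClosed_exists_litHolds m C
  exact h'.inter (isClosed_exists_litHolds m q)

/-- The sum in the proof exceeds every variable of `C`, so at that stage no literal of `C` holds by
default. -/
theorem exists_true_of_litHolds {z : ℕ → Bool} {C : List (ℕ × Bool)} (k : ℕ)
    (h : ∀ m, k ≤ m → ∃ l ∈ C, LitHolds m z l) : ∃ l ∈ C, z l.1 = l.2 := by
  obtain ⟨l, hl, h'⟩ := h (k + (C.map fun l => l.1 + 1).sum) (Nat.le_add_right _ _)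
  refine ⟨l, hl, h'.resolve_left fun hle => ?_⟩
  have := List.le_sum_of_mem (List.mem_map_of_mem (f := fun l : ℕ × Bool => l.1 + 1) hl)
  omega

/-- Propositional compactness, in a form in which every finite stage is a bounded search. -/
theorem exists_sat_iff_forall_partialSat (cl : ℕ → List (List (ℕ × Bool)))
    (q : List (ℕ × Bool)) :
    (∃ z : ℕ → Bool, (∀ c, ∀ C ∈ cl c, ∃ l ∈ C, z l.1 = l.2) ∧ ∃ l ∈ q, z l.1 = l.2) ↔
      ∀ m, ∃ s < 2 ^ m, PartialSat cl q m s.testBit := by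
  constructor
  · rintro ⟨z, hz, hq⟩ m
    refine ⟨Nat.ofBits fun i : Fin m => z i, Nat.ofBits_lt_two_pow _, ?_⟩
    have key : ∀ l : ℕ × Bool, z l.1 = l.2 →
        LitHolds m (Nat.ofBits fun i : Fin m => z i).testBit l := by
      intro l hl
      rcases le_or_gt m l.1 with h | h
      · exact Or.inl h
      · exact Or.inr (by rw [Nat.testBit_ofBits_lt _ _ h, ← hl])
    refine ⟨fun c _ C hC => ?_, ?_⟩
    · obtain ⟨l, hl, h⟩ := hz c C hC
      exact ⟨l, hl, key l h⟩
    · obtain ⟨l, hl, h⟩ := hq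
      exact ⟨l, hl, key l h⟩
  · intro h
    obtain ⟨z, hz⟩ := IsCompact.nonempty_iInter_of_sequence_nonempty_isCompact_isClosed
      (fun m => {z | PartialSat cl q m z}) (fun m z hz => PartialSat.anti m.le_succ hz)
      (fun m => (h m).elim fun s hs => ⟨s.testBit, hs.2⟩) (isClosed_partialSat cl q 0).isCompact
      (isClosed_partialSat cl q)
    simp only [Set.mem_iInter, Set.mem_ofPred_eq] at hz
    exact ⟨z, fun c C hC => exists_true_of_litHolds (c + 1) fun m hm => (hz m).1 c hm C hC,
      exists_true_of_litHolds 0 fun m _ => (hz m).2⟩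

theorem primrec_pow : Primrec₂ ((· ^ ·) : ℕ → ℕ → ℕ) :=
  Primrec₂.unpaired'.1 Nat.Primrec.pow

theorem primrec_testBit : Primrec₂ Nat.testBit := by
  have h : PrimrecRel fun s i : ℕ => s / 2 ^ i % 2 = 1 :=
    Primrec.eq.comp (Primrec.nat_mod.comp (Primrec.nat_div.comp Primrec.fst
      (primrec_pow.comp (Primrec.const 2) Primrec.snd)) (Primrec.const 2)) (Primrec.const 1)
  exact h.decide.of_eq fun s i => by rw [Nat.testBit_eq_decide_div_mod_eq]

/-- Unsatisfiability of a primitive recursive set of clauses together with a clause computed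
from `n` is the projection of a primitive recursive relation. -/
theorem exists_primrecRel_unsat {cl : ℕ → List (List (ℕ × Bool))} (hcl : Primrec cl)
    {q : ℕ → List (ℕ × Bool)} (hq : Primrec q) :
    ∃ R : ℕ → ℕ → Prop, PrimrecRel R ∧ ∀ n, (∃ m, R n m) ↔
      ∀ z : ℕ → Bool, (∀ c, ∀ C ∈ cl c, ∃ l ∈ C, z l.1 = l.2) → ¬ ∃ l ∈ q n, z l.1 = l.2 := by
  -- The certificate `m` is a stage at which none of the `2 ^ m` assignments to the variables below
  -- `m` survives.
  refine ⟨fun n m => ¬ ∃ s < 2 ^ m, PartialSat cl (q n) m s.testBit, ?_, fun n => ?_⟩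
  · have hlit : PrimrecRel fun (l : ℕ × Bool) (p : ℕ × ℕ) => LitHolds p.1 p.2.testBit l :=
      PrimrecPred.or (Primrec.nat_le.comp (Primrec.fst.comp Primrec.snd)
          (Primrec.fst.comp Primrec.fst))
        (Primrec.eq.comp (primrec_testBit.comp (Primrec.snd.comp Primrec.snd)
          (Primrec.fst.comp Primrec.fst)) (Primrec.snd.comp Primrec.fst))
    have hC := hlit.exists_mem_list
    have hcls : PrimrecRel fun (c : ℕ) (p : ℕ × ℕ) =>
        ∀ C ∈ cl c, ∃ l ∈ C, LitHolds p.1 p.2.testBit l :=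
      hC.forall_mem_list.comp (hcl.comp Primrec.fst) Primrec.snd
    have hall := hcls.forall_mem_list
    have hsat : PrimrecRel fun (s : ℕ) (p : ℕ × ℕ) => PartialSat cl (q p.1) p.2 s.testBit := by
      refine (PrimrecPred.and
        (hall.comp (Primrec.list_range.comp (Primrec.snd.comp Primrec.snd))
          (Primrec.pair (Primrec.snd.comp Primrec.snd) Primrec.fst))
        (hC.comp (hq.comp (Primrec.fst.comp Primrec.snd))
          (Primrec.pair (Primrec.snd.comp Primrec.snd) Primrec.fst))).of_eq fun p => ?_
      simp only [List.mem_range, PartialSat]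
    refine ((hsat.exists_mem_list.comp
      (Primrec.list_range.comp (primrec_pow.comp (Primrec.const 2) Primrec.snd))
      (Primrec.pair Primrec.fst Primrec.snd)).not).of_eq fun p => ?_
    simp only [List.mem_range]
  · rw [← not_forall, ← exists_sat_iff_forall_partialSat]
    simp only [not_exists, not_and]

theorem rePred_exists {R : ℕ → ℕ → Prop} (hR : PrimrecRel R) : REPred fun n => ∃ m, R n m := by
  classical
  have h : Partrec fun n => Nat.rfind fun m => Part.some (decide (R n m)) :=
    Partrec.rfind (Primrec₂.to_comp hR.decide).partrec₂
  refine h.dom_re.of_eq fun n => ?_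
  refine Nat.rfind_dom.trans ?_
  simp

/-! ### Clauses describing truth after deletions -/

/-- The propositional variable saying that the formula coded by `x` is true at the world `a`
after the deletions coded by `D`. -/
def tVar (x D a : ℕ) : ℕ := Nat.pair 0 (Nat.pair x (Nat.pair D a))

/-- The propositional variable saying that after the deletions coded by `D` there is a link from
`a` to `b`. -/
def rVar (D a b : ℕ) : ℕ := Nat.pair 1 (Nat.pair D (Nat.pair a b))

/-- The propositional variable saying that `x` is the code of a formula. -/
def fVar (x : ℕ) : ℕ := Nat.pair 2 x

/-- The propositional variable saying that `k` is in the range of the map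
`fun n => encode (decode n)`. -/
def gVar (k : ℕ) : ℕ := Nat.pair 3 k

/-- The code of a list of deletions, extended by the deletion at `a` of the links to points that
satisfy the formula coded by `x`. -/
def consDel (a x D : ℕ) : ℕ := Nat.pair (Nat.pair a x) D + 1

/-- The clauses that describe truth in a model with domain `ℕ`, for one tuple of parameters. -/
def clausesAt (P : Type u) [Encodable P] (x y D a b : ℕ) : List (List (ℕ × Bool)) :=
  [ [(tVar (Nat.pair 1 x) D a, true), (tVar x D a, true)],
    [(tVar (Nat.pair 1 x) D a, false), (tVar x D a, false)],
    [(tVar (Nat.pair 2 (Nat.pair x y)) D a, false), (tVar x D a, true)],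
    [(tVar (Nat.pair 2 (Nat.pair x y)) D a, false), (tVar y D a, true)],
    [(tVar (Nat.pair 2 (Nat.pair x y)) D a, true), (tVar x D a, false), (tVar y D a, false)],
    [(tVar (Nat.pair 4 (Nat.pair x y)) D a, false), (tVar y (consDel a x D) a, true)],
    [(tVar (Nat.pair 4 (Nat.pair x y)) D a, true), (tVar y (consDel a x D) a, false)],
    [(rVar (consDel y x D) a b, false), (rVar D a b, true)],
    [(rVar (consDel a x D) a b, false), (tVar x D b, false)],
    [(rVar (consDel a x D) a b, true), (rVar D a b, false), (tVar x D b, true)],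
    [(rVar (consDel a x D) (a + y + 1) b, true), (rVar D (a + y + 1) b, false)],
    [(rVar (consDel (a + y + 1) x D) a b, true), (rVar D a b, false)],
    -- A link from `a` survives the deletion of the links to `x`-points exactly when it leads to a
    -- counterexample to the box. A single link literal can thus stand for a link together with the
    -- falsity of `x` at its end.
    [(tVar (Nat.pair 3 x) D a, false), (rVar (consDel a x D) a b, false)],
    (tVar (Nat.pair 3 x) D a, true) :: (List.range (Nat.pair x (Nat.pair D a) + 2)).map
      fun b => (rVar (consDel a x D) a b, true),
    [(tVar (Nat.pair 0 x) D a, false), (tVar (Nat.pair 0 x) 0 a, true)],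
    [(tVar (Nat.pair 0 x) D a, true), (tVar (Nat.pair 0 x) 0 a, false)],
    -- The value is `0` if `x` decodes to nothing and otherwise the successor of the number of an
    -- atom; hence the `x + 1` in the next clause.
    [(gVar (Encodable.encode (Encodable.decode (α := P) x)), true)],
    [(gVar (x + 1), false), (fVar (Nat.pair 0 x), true)],
    [(fVar x, false), (fVar (Nat.pair 1 x), true)],
    [(fVar x, false), (fVar y, false), (fVar (Nat.pair 2 (Nat.pair x y)), true)],
    [(fVar x, false), (fVar (Nat.pair 3 x), true)],
    [(fVar x, false), (fVar y, false), (fVar (Nat.pair 4 (Nat.pair x y)), true)] ]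

/-- `clausesAt`, with the parameters packed into one number. -/
def clauses (P : Type u) [Encodable P] (c : ℕ) : List (List (ℕ × Bool)) :=
  clausesAt P c.unpair.1 c.unpair.2.unpair.1 c.unpair.2.unpair.2.unpair.1
    c.unpair.2.unpair.2.unpair.2.unpair.1 c.unpair.2.unpair.2.unpair.2.unpair.2

theorem forall_clauses_iff {P : Type u} [Encodable P] {z : ℕ → Bool} :
    (∀ c, ∀ C ∈ clauses P c, ∃ l ∈ C, z l.1 = l.2) ↔
      ∀ x y D a b, ∀ C ∈ clausesAt P x y D a b, ∃ l ∈ C, z l.1 = l.2 := by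
  refine ⟨fun h x y D a b => ?_, fun h c => h _ _ _ _ _⟩
  simpa [clauses] using h (Nat.pair x (Nat.pair y (Nat.pair D (Nat.pair a b))))

section Primrec

variable {α : Type*} [Primcodable α] {f g h : α → ℕ}

theorem primrec_tVar (hf : Primrec f) (hg : Primrec g) (hh : Primrec h) :
    Primrec fun c => tVar (f c) (g c) (h c) :=
  Primrec₂.natPair.comp (Primrec.const 0)
    (Primrec₂.natPair.comp hf (Primrec₂.natPair.comp hg hh))

theorem primrec_rVar (hf : Primrec f) (hg : Primrec g) (hh : Primrec h) :
    Primrec fun c => rVar (f c) (g c) (h c) :=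
  Primrec₂.natPair.comp (Primrec.const 1)
    (Primrec₂.natPair.comp hf (Primrec₂.natPair.comp hg hh))

theorem primrec_fVar (hf : Primrec f) : Primrec fun c => fVar (f c) :=
  Primrec₂.natPair.comp (Primrec.const 2) hf

theorem primrec_gVar (hf : Primrec f) : Primrec fun c => gVar (f c) :=
  Primrec₂.natPair.comp (Primrec.const 3) hf

theorem primrec_consDel (hf : Primrec f) (hg : Primrec g) (hh : Primrec h) :
    Primrec fun c => consDel (f c) (g c) (h c) :=
  Primrec.succ.comp (Primrec₂.natPair.comp (Primrec₂.natPair.comp hf hg) hh)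

end Primrec

theorem primrec_clausesAt (P : Type u) [Primcodable P] {x y D a b : ℕ → ℕ} (hx : Primrec x)
    (hy : Primrec y) (hD : Primrec D) (ha : Primrec a) (hb : Primrec b) :
    Primrec fun c => clausesAt P (x c) (y c) (D c) (a c) (b c) := by
  have hcons : ∀ {β : Type} [Primcodable β] {f : ℕ → β} {g : ℕ → List β}, Primrec f →
      Primrec g → Primrec fun c => f c :: g c := fun hf hg => Primrec.list_cons.comp hf hg
  have hlit : ∀ {f : ℕ → ℕ} (s : Bool), Primrec f → Primrec fun c => (f c, s) :=
    fun s hf => Primrec.pair hf (Primrec.const s)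
  have hp : ∀ {f g : ℕ → ℕ}, Primrec f → Primrec g → Primrec fun c => Nat.pair (f c) (g c) :=
    fun hf hg => Primrec₂.natPair.comp hf hg
  have hne : Primrec fun c => a c + y c + 1 := Primrec.succ.comp (Primrec.nat_add.comp ha hy)
  have hbox : Primrec fun c =>
      (List.range (Nat.pair (x c) (Nat.pair (D c) (a c)) + 2)).map fun b =>
        (rVar (consDel (a c) (x c) (D c)) (a c) b, true) :=
    Primrec.list_map
      (Primrec.list_range.comp (Primrec.succ.comp (Primrec.succ.comp (hp hx (hp hD ha)))))
      (Primrec.pair (primrec_rVar (primrec_consDel (ha.comp Primrec.fst) (hx.comp Primrec.fst)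
        (hD.comp Primrec.fst)) (ha.comp Primrec.fst) Primrec.snd) (Primrec.const true))
  have henc : Primrec fun c => Encodable.encode (Encodable.decode (α := P) (x c)) :=
    Primrec.encode.comp (Primrec.decode.comp hx)
  unfold clausesAt
  have hx1 : Primrec fun c => x c + 1 := Primrec.succ.comp hx
  repeat first
    | with_reducible exact Primrec.const _
    | with_reducible assumption
    | with_reducible apply hcons
    | with_reducible apply hlit
    | with_reducible apply primrec_tVar
    | with_reducible apply primrec_rVar
    | with_reducible apply primrec_fVar
    | with_reducible apply primrec_gVar
    | with_reducible apply primrec_consDel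
    | with_reducible apply hp

theorem primrec_clauses (P : Type u) [Primcodable P] : Primrec (clauses P) := by
  have u1 : Primrec fun c : ℕ => c.unpair.1 := Primrec.fst.comp Primrec.unpair
  have u2 : Primrec fun c : ℕ => c.unpair.2 := Primrec.snd.comp Primrec.unpair
  exact primrec_clausesAt P u1 (u1.comp u2) (u1.comp (u2.comp u2))
    (u1.comp (u2.comp (u2.comp u2))) (u2.comp (u2.comp (u2.comp u2)))

/-! ### Decoding formulas and lists of deletions -/

theorem lt_pair_succ (k x : ℕ) : x < Nat.pair (k + 1) x :=
  (Nat.lt_add_of_pos_left k.succ_pos).trans_le (Nat.add_le_pair _ _)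

/-- The formula with a given code; numbers that are not codes are read as `atom p₀`, or as
formulas built with `p₀` in the place of atoms that do not exist. -/
noncomputable def decodeFormula {P : Type u} [Encodable P] (p₀ : P) (n : ℕ) : Formula P :=
  match h : n.unpair with
  | (0, k) => .atom ((Encodable.decode k).getD p₀)
  | (1, x) => .neg (decodeFormula p₀ x)
  | (2, k) => .and (decodeFormula p₀ k.unpair.1) (decodeFormula p₀ k.unpair.2)
  | (3, x) => .box (decodeFormula p₀ x)
  | (4, k) => .sab (decodeFormula p₀ k.unpair.1) (decodeFormula p₀ k.unpair.2)
  | (_ + 5, _) => .atom p₀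
termination_by n
decreasing_by
  all_goals
    have hn := congrArg (fun q : ℕ × ℕ => Nat.pair q.1 q.2) h
    simp only [Nat.pair_unpair] at hn
    subst hn
  · exact lt_pair_succ _ _
  · exact (Nat.unpair_left_le _).trans_lt (lt_pair_succ _ _)
  · exact (Nat.unpair_right_le _).trans_lt (lt_pair_succ _ _)
  · exact lt_pair_succ _ _
  · exact (Nat.unpair_left_le _).trans_lt (lt_pair_succ _ _)
  · exact (Nat.unpair_right_le _).trans_lt (lt_pair_succ _ _)

section decodeFormula

variable {P : Type u} [Encodable P] (p₀ : P) (x y : ℕ)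

theorem decodeFormula_atom : decodeFormula p₀ (Nat.pair 0 x) =
    .atom ((Encodable.decode x).getD p₀) := by
  rw [decodeFormula]
  split <;> simp_all

theorem decodeFormula_neg : decodeFormula p₀ (Nat.pair 1 x) = .neg (decodeFormula p₀ x) := by
  rw [decodeFormula]
  split <;> simp_all

theorem decodeFormula_and : decodeFormula p₀ (Nat.pair 2 (Nat.pair x y)) =
    .and (decodeFormula p₀ x) (decodeFormula p₀ y) := by
  rw [decodeFormula]
  split <;> simp_all
  rename_i h
  simp [← h]

theorem decodeFormula_box : decodeFormula p₀ (Nat.pair 3 x) = .box (decodeFormula p₀ x) := by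
  rw [decodeFormula]
  split <;> simp_all

theorem decodeFormula_sab : decodeFormula p₀ (Nat.pair 4 (Nat.pair x y)) =
    .sab (decodeFormula p₀ x) (decodeFormula p₀ y) := by
  rw [decodeFormula]
  split <;> simp_all
  rename_i h
  simp [← h]

theorem decodeFormula_code (φ : Formula P) : decodeFormula p₀ φ.code = φ := by
  induction φ with
  | atom p => simp [Formula.code, decodeFormula_atom]
  | neg φ ih => rw [Formula.code, decodeFormula_neg, ih]
  | and φ ψ ih₁ ih₂ => rw [Formula.code, decodeFormula_and, ih₁, ih₂]
  | box φ ih => rw [Formula.code, decodeFormula_box, ih]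
  | sab φ ψ ih₁ ih₂ => rw [Formula.code, decodeFormula_sab, ih₁, ih₂]

end decodeFormula

/-- The model after the deletions coded by `D`, where `e a` is the world with number `a`. -/
noncomputable def deleteAll {P : Type u} [Encodable P] (p₀ : P) {W : Type v} (M : Model P W)
    (e : ℕ → W) : ℕ → Model P W
  | 0 => M
  | k + 1 =>
    have : k.unpair.2 < k + 1 := Nat.lt_succ_of_le (Nat.unpair_right_le k)
    (deleteAll p₀ M e k.unpair.2).delete (e k.unpair.1.unpair.1)
      {w | (decodeFormula p₀ k.unpair.1.unpair.2).Sat (deleteAll p₀ M e k.unpair.2) w}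

section deleteAll

variable {P : Type u} [Encodable P] (p₀ : P) {W : Type v} (M : Model P W)

theorem deleteAll_consDel (e : ℕ → W) (a x D : ℕ) : deleteAll p₀ M e (consDel a x D) =
    (deleteAll p₀ M e D).delete (e a)
      {w | (decodeFormula p₀ x).Sat (deleteAll p₀ M e D) w} := by
  rw [consDel, deleteAll]
  simp

theorem deleteAll_zero (e : ℕ → W) : deleteAll p₀ M e 0 = M := by
  rw [deleteAll]

theorem deleteAll_V (e : ℕ → W) (D : ℕ) : (deleteAll p₀ M e D).V = M.V := by
  induction D using Nat.strong_induction_on with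
  | _ D ih =>
    cases D with
    | zero => rw [deleteAll_zero]
    | succ k =>
      rw [deleteAll]
      exact ih _ (Nat.lt_succ_of_le (Nat.unpair_right_le k))

/-- A pair bounds its components and `consDel` adds one, so every world number occurring in `D` is
below `D`. The deletions can thus be carried out when only an initial part of the numbering is
fixed. -/
theorem deleteAll_congr {e f : ℕ → W} (D : ℕ) (h : ∀ a < D, e a = f a) :
    deleteAll p₀ M e D = deleteAll p₀ M f D := by
  induction D using Nat.strong_induction_on with
  | _ D ih =>
    cases D with
    | zero => rw [deleteAll_zero, deleteAll_zero]
    | succ k =>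
      have h2 : k.unpair.2 < k + 1 := Nat.lt_succ_of_le (Nat.unpair_right_le k)
      have h1 : k.unpair.1.unpair.1 < k + 1 :=
        Nat.lt_succ_of_le ((Nat.unpair_left_le _).trans (Nat.unpair_left_le k))
      rw [deleteAll, deleteAll, ih _ h2 fun a ha => h a (ha.trans h2), h _ h1]

end deleteAll

/-! ### Countable submodels with bounded witnesses -/

/-- Sequences can be defined by dependent choice, subject to requirements that involve only the
earlier terms. -/
theorem exists_seq_of_forall_exists {α : Type v} (a₀ : α) (Q : ℕ → (ℕ → α) → α → Prop)
    (hcongr : ∀ n f g v, (∀ i ≤ n, f i = g i) → Q n f v → Q n g v)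
    (hex : ∀ n f, ∃ v, Q n f v) : ∃ e : ℕ → α, e 0 = a₀ ∧ ∀ n, Q n e (e (n + 1)) := by
  choose F hF using hex
  -- `E n` has the first terms right up to index `n` and the default value `a₀` beyond.
  let E : ℕ → ℕ → α := fun n => n.rec (fun _ => a₀) fun n f => Function.update f (n + 1) (F n f)
  have hE : ∀ n, E (n + 1) = Function.update (E n) (n + 1) (F n (E n)) := fun n => rfl
  have hstab : ∀ n i, i ≤ n → E n i = E i i := by
    intro n
    induction n with
    | zero => intro i hi; rw [Nat.le_zero.1 hi]
    | succ n ih =>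
      intro i hi
      rcases Nat.of_le_succ hi with h | h
      · rw [hE, Function.update_of_ne (by omega), ih i h]
      · rw [h]
  refine ⟨fun n => E n n, rfl, fun n => hcongr n (E n) _ _ (hstab n) ?_⟩
  have : E (n + 1) (n + 1) = F n (E n) := by rw [hE, Function.update_self]
  change Q n (E n) (E (n + 1) (n + 1))
  rw [this]
  exact hF n (E n)

/-- The worlds that a countable submodel needs can be numbered in such a way that there is a
computable bound for the number of a witness. -/
theorem exists_numbering {P : Type u} [Encodable P] (p₀ : P) {W : Type v} [Infinite W]
    (M : Model P W) (w₀ : W) : ∃ e : ℕ → W, e 0 = w₀ ∧ Function.Injective e ∧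
      ∀ x D a w, (deleteAll p₀ M e D).R (e a) w → ¬ (decodeFormula p₀ x).Sat
        (deleteAll p₀ M e D) w → ∃ b < Nat.pair x (Nat.pair D a) + 2,
          (deleteAll p₀ M e D).R (e a) (e b) ∧
            ¬ (decodeFormula p₀ x).Sat (deleteAll p₀ M e D) (e b) := by
  let wit : ℕ → (ℕ → W) → W → Prop := fun n f w =>
    (deleteAll p₀ M f n.unpair.2.unpair.1).R (f n.unpair.2.unpair.2) w ∧
      ¬ (decodeFormula p₀ n.unpair.1).Sat (deleteAll p₀ M f n.unpair.2.unpair.1) w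
  have hwit : ∀ n f g, (∀ i ≤ n, f i = g i) → wit n f = wit n g := by
    intro n f g h
    have h2 := Nat.unpair_right_le n
    have h3 : f n.unpair.2.unpair.2 = g n.unpair.2.unpair.2 :=
      h _ ((Nat.unpair_right_le _).trans h2)
    have h4 : deleteAll p₀ M f n.unpair.2.unpair.1 = deleteAll p₀ M g n.unpair.2.unpair.1 :=
      deleteAll_congr p₀ M _ fun a ha => h a (ha.le.trans ((Nat.unpair_left_le _).trans h2))
    simp only [wit, h3, h4]
  obtain ⟨e, he0, he⟩ := exists_seq_of_forall_exists w₀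
    -- World `n + 1` must be new, and must be a witness for the task coded by `n` if some new world
    -- is one. If none is, infinitude of `W` still supplies a new world.
    (fun n f v => (∀ i ≤ n, f i ≠ v) ∧ ((∃ w, wit n f w ∧ ∀ i ≤ n, f i ≠ w) → wit n f v))
    (fun n f g v h hv => by
      have h1 : ∀ w, (∀ i ≤ n, g i ≠ w) ↔ ∀ i ≤ n, f i ≠ w := fun w =>
        forall₂_congr fun i hi => by rw [h i hi]
      simpa only [h1, ← hwit n f g h] using hv)
    (fun n f => by
      by_cases hw : ∃ w, wit n f w ∧ ∀ i ≤ n, f i ≠ w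
      · obtain ⟨w, hw1, hw2⟩ := hw
        exact ⟨w, hw2, fun _ => hw1⟩
      · obtain ⟨w, hw'⟩ := ((Set.finite_Iic n).image f).infinite_compl.nonempty
        exact ⟨w, fun i hi h => hw' ⟨i, hi, h⟩, fun h => absurd h hw⟩)
  refine ⟨e, he0, ?_, fun x D a w hR hS => ?_⟩
  · have hlt : ∀ i j, i < j → e i ≠ e j := by
      intro i j hij
      obtain ⟨n, rfl⟩ := Nat.exists_eq_succ_of_ne_zero (Nat.ne_zero_of_lt hij)
      exact (he n).1 i (Nat.lt_succ_iff.1 hij)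
    exact fun i j hij => by
      rcases lt_trichotomy i j with h | h | h
      · exact absurd hij (hlt _ _ h)
      · exact h
      · exact absurd hij.symm (hlt _ _ h)
  · set n := Nat.pair x (Nat.pair D a) with hn
    have hw : wit n e w := by simpa [wit, hn] using ⟨hR, hS⟩
    -- Either the given witness already has an index at most `n`, or world `n + 1` was chosen as a
    -- witness; hence the bound `n + 2`.
    have : ∃ b < n + 2, wit n e (e b) := by
      by_cases h : ∃ i ≤ n, e i = w
      · obtain ⟨i, hi, rfl⟩ := h
        exact ⟨i, by omega, hw⟩
      · exact ⟨n + 1, by omega, (he n).2 ⟨w, hw, fun i hi hiw => h ⟨i, hi, hiw⟩⟩⟩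
    simpa [wit, hn] using this

/-- A formula holds at a point of a model if and only if it holds at its image in a model that
has the first one as a generated submodel. -/
theorem sat_map_iff {P : Type u} {W W' : Type*} {i : W → W'} (hi : Function.Injective i)
    (φ : Formula P) : ∀ (M : Model P W) (M' : Model P W'),
      (∀ a y, M'.R (i a) y ↔ ∃ b, y = i b ∧ M.R a b) → (∀ p a, i a ∈ M'.V p ↔ a ∈ M.V p) →
      ∀ a, φ.Sat M' (i a) ↔ φ.Sat M a := by
  induction φ with
  | atom p => intro M M' _ hV a; exact hV p a
  | neg φ ih => intro M M' hR hV a; exact not_congr (ih M M' hR hV a)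
  | and φ ψ ih₁ ih₂ =>
    intro M M' hR hV a
    exact and_congr (ih₁ M M' hR hV a) (ih₂ M M' hR hV a)
  | box φ ih =>
    intro M M' hR hV a
    simp only [Formula.Sat, hR, forall_exists_index, and_imp]
    exact ⟨fun h b hb => (ih M M' hR hV b).1 (h _ b rfl hb),
      fun h y b hy hb => hy ▸ (ih M M' hR hV b).2 (h b hb)⟩
  | sab φ ψ ih₁ ih₂ =>
    intro M M' hR hV a
    -- By `ih₁` the deleted sets correspond under `i`, so the deletions preserve the generated
    -- submodel.
    refine ih₂ (M.delete a {x | φ.Sat M x}) (M'.delete (i a) {x | φ.Sat M' x})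
      (fun c y => ?_) hV a
    simp only [Model.delete, hR, Set.mem_ofPred_eq, hi.eq_iff]
    constructor
    · rintro ⟨⟨b, rfl, hb⟩, h⟩
      rw [ih₁ M M' hR hV b] at h
      exact ⟨b, rfl, hb, h⟩
    · rintro ⟨b, rfl, hb, h⟩
      rw [← ih₁ M M' hR hV b] at h
      exact ⟨⟨b, rfl, hb⟩, h⟩

/-- Adding isolated points leaves the old domain a generated submodel, so truth at old points is
unchanged. The infinite domain makes room for an injective numbering. -/
theorem exists_infinite_model {P : Type u} {W : Type v} (M : Model P W) (w : W) (φ : Formula P) :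
    ∃ (M' : Model P (W ⊕ ℕ)), φ.Sat M' (Sum.inl w) ↔ φ.Sat M w :=
  ⟨⟨fun x y => ∃ a b, x = Sum.inl a ∧ y = Sum.inl b ∧ M.R a b, fun p => Sum.inl '' M.V p⟩,
    sat_map_iff Sum.inl_injective φ M _ (by simp) (by simp) w⟩

/-! ### From models to valuations -/

open Classical in
/-- The valuation of the propositional variables that a numbered model determines. -/
noncomputable def valuation {P : Type u} [Encodable P] (p₀ : P) {W : Type v} (M : Model P W)
    (e : ℕ → W) (i : ℕ) : Bool :=
  match i.unpair with
  | (0, j) => decide ((decodeFormula p₀ j.unpair.1).Sat (deleteAll p₀ M e j.unpair.2.unpair.1)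
      (e j.unpair.2.unpair.2))
  | (1, j) => decide ((deleteAll p₀ M e j.unpair.1).R (e j.unpair.2.unpair.1)
      (e j.unpair.2.unpair.2))
  | (2, j) => decide (∃ φ : Formula P, φ.code = j)
  | (_ + 3, j) => decide (∃ k, Encodable.encode (Encodable.decode (α := P) k) = j)

section valuation

variable {P : Type u} [Encodable P] (p₀ : P) {W : Type v} (M : Model P W) (e : ℕ → W)

theorem valuation_tVar (x D a : ℕ) : valuation p₀ M e (tVar x D a) = true ↔
    (decodeFormula p₀ x).Sat (deleteAll p₀ M e D) (e a) := by
  simp [valuation, tVar]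

theorem valuation_rVar (D a b : ℕ) : valuation p₀ M e (rVar D a b) = true ↔
    (deleteAll p₀ M e D).R (e a) (e b) := by
  simp [valuation, rVar]

theorem valuation_fVar (x : ℕ) : valuation p₀ M e (fVar x) = true ↔
    ∃ φ : Formula P, φ.code = x := by
  simp [valuation, fVar]

theorem valuation_gVar (j : ℕ) : valuation p₀ M e (gVar j) = true ↔
    ∃ k, Encodable.encode (Encodable.decode (α := P) k) = j := by
  simp [valuation, gVar]

/-- Injectivity of `e` is needed where a deletion at one number must leave the links from another
number alone, and `hw` for the long clause about boxes. The other clauses hold by the definitions of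
truth, deletion and coding. -/
theorem valuation_sat_clausesAt (he : Function.Injective e)
    (hw : ∀ x D a w, (deleteAll p₀ M e D).R (e a) w → ¬ (decodeFormula p₀ x).Sat
        (deleteAll p₀ M e D) w → ∃ b < Nat.pair x (Nat.pair D a) + 2,
          (deleteAll p₀ M e D).R (e a) (e b) ∧
            ¬ (decodeFormula p₀ x).Sat (deleteAll p₀ M e D) (e b))
    (x y D a b : ℕ) : ∀ C ∈ clausesAt P x y D a b, ∃ l ∈ C, valuation p₀ M e l.1 = l.2 := by
  have hatom : ∀ p D, (Formula.atom p).Sat (deleteAll p₀ M e D) (e a) ↔ e a ∈ M.V p :=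
    fun p D => by rw [Formula.Sat, deleteAll_V]
  have hne : e (a + y + 1) ≠ e a := fun h => absurd (he h) (by omega)
  simp only [clausesAt, List.forall_mem_cons, List.exists_mem_cons_iff, List.not_mem_nil,
    false_and, exists_false, or_false, IsEmpty.forall_iff, implies_true, and_true,
    ← Bool.not_eq_true, valuation_tVar, valuation_rVar, valuation_fVar, valuation_gVar,
    decodeFormula_neg, decodeFormula_and, decodeFormula_box, decodeFormula_sab,
    decodeFormula_atom, deleteAll_consDel, hatom, List.mem_map, List.mem_range]
  simp only [Formula.Sat, Model.delete, Set.mem_ofPred_eq]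
  refine ⟨em' _, em' _, imp_iff_not_or.1 And.left, imp_iff_not_or.1 And.right, ?_, em' _, em _,
    imp_iff_not_or.1 And.left, ?_, ?_, imp_iff_or_not.1 fun h => ⟨h, fun h' => hne h'.1⟩,
    imp_iff_or_not.1 fun h => ⟨h, fun h' => hne h'.1.symm⟩,
    imp_iff_not_or.1 fun h h' => h'.2 ⟨trivial, h _ h'.1⟩, ?_, em' _, em _, ⟨x, rfl⟩,
    imp_iff_not_or.1 ?_, imp_iff_not_or.1 ?_, imp_iff_not_or.1 fun h => imp_iff_not_or.1 ?_,
    imp_iff_not_or.1 ?_, imp_iff_not_or.1 fun h => imp_iff_not_or.1 ?_⟩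
  · tauto
  · tauto
  · tauto
  · refine or_iff_not_imp_left.2 fun h => ?_
    push Not at h
    obtain ⟨w, hR, hS⟩ := h
    obtain ⟨b, hb, hR', hS'⟩ := hw x D a w hR hS
    refine ⟨_, ⟨b, hb, rfl⟩, ?_⟩
    rw [valuation_rVar, deleteAll_consDel]
    exact ⟨hR', fun h => hS' h.2⟩
  · rintro ⟨k, hk⟩
    cases hd : (Encodable.decode k : Option P) with
    | none => simp [hd] at hk
    | some p =>
      rw [hd, Encodable.encode_some, Nat.succ_inj] at hk
      exact ⟨.atom p, by rw [Formula.code, hk]⟩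
  · rintro ⟨φ, rfl⟩
    exact ⟨.neg φ, rfl⟩
  · obtain ⟨φ, rfl⟩ := h
    rintro ⟨ψ, rfl⟩
    exact ⟨.and φ ψ, rfl⟩
  · rintro ⟨φ, rfl⟩
    exact ⟨.box φ, rfl⟩
  · obtain ⟨φ, rfl⟩ := h
    rintro ⟨ψ, rfl⟩
    exact ⟨.sab φ ψ, rfl⟩

end valuation

theorem exists_valuation {P : Type u} [Encodable P] (p₀ : P) {W : Type v} (M : Model P W)
    (φ : Formula P) (w : W) : ∃ z : ℕ → Bool,
    (∀ c, ∀ C ∈ clauses P c, ∃ l ∈ C, z l.1 = l.2) ∧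
      (z (tVar φ.code 0 0) = true ↔ φ.Sat M w) ∧
      ∀ n, z (fVar n) = true ↔ ∃ ψ : Formula P, ψ.code = n := by
  obtain ⟨M', hM'⟩ := exists_infinite_model M w φ
  obtain ⟨e, he0, he, hw⟩ := exists_numbering p₀ M' (Sum.inl w)
  refine ⟨valuation p₀ M' e, forall_clauses_iff.2 (valuation_sat_clausesAt p₀ M' e he hw), ?_,
    valuation_fVar p₀ M' e⟩
  rw [valuation_tVar, decodeFormula_code, deleteAll_zero, he0, hM']

/-! ### From valuations to models -/

section modelOf

variable {P : Type u} [Encodable P] {z : ℕ → Bool}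

/-- The clauses only close `fVar` under the formation rules and may be satisfied with `fVar` true
elsewhere. For entailment this is enough, since the valuations obtained from models make `fVar` true
at codes only. -/
theorem fVar_code_of_clauses (hz : ∀ c, ∀ C ∈ clauses P c, ∃ l ∈ C, z l.1 = l.2)
    (φ : Formula P) : z (fVar φ.code) = true := by
  have h := forall_clauses_iff.1 hz
  simp only [clausesAt, List.forall_mem_cons, List.exists_mem_cons_iff, List.not_mem_nil,
    false_and, exists_false, or_false, ← Bool.not_eq_true] at h
  induction φ with
  | atom p =>
    obtain ⟨-, -, -, -, -, -, -, -, -, -, -, -, -, -, -, -, h1, -⟩ := h (Encodable.encode p) 0 0 0 0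
    obtain ⟨-, -, -, -, -, -, -, -, -, -, -, -, -, -, -, -, -, h2, -⟩ :=
      h (Encodable.encode p) 0 0 0 0
    rw [Encodable.encodek, Encodable.encode_some] at h1
    exact h2.resolve_left (not_not.2 h1)
  | neg φ ih =>
    obtain ⟨-, -, -, -, -, -, -, -, -, -, -, -, -, -, -, -, -, -, h1, -⟩ := h φ.code 0 0 0 0
    exact h1.resolve_left (not_not.2 ih)
  | and φ ψ ih₁ ih₂ =>
    obtain ⟨-, -, -, -, -, -, -, -, -, -, -, -, -, -, -, -, -, -, -, h1, -⟩ := h φ.code ψ.code 0 0 0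
    exact (h1.resolve_left (not_not.2 ih₁)).resolve_left (not_not.2 ih₂)
  | box φ ih =>
    obtain ⟨-, -, -, -, -, -, -, -, -, -, -, -, -, -, -, -, -, -, -, -, h1, -⟩ := h φ.code 0 0 0 0
    exact h1.resolve_left (not_not.2 ih)
  | sab φ ψ ih₁ ih₂ =>
    obtain ⟨-, -, -, -, -, -, -, -, -, -, -, -, -, -, -, -, -, -, -, -, -, h1, -⟩ :=
      h φ.code ψ.code 0 0 0
    exact (h1.resolve_left (not_not.2 ih₁)).resolve_left (not_not.2 ih₂)

/-- The model that a valuation of the propositional variables describes. -/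
def modelOf (P : Type u) [Encodable P] (z : ℕ → Bool) : Model P (ULift.{v} ℕ) where
  R a b := z (rVar 0 a.down b.down) = true
  V p := {a | z (tVar (Formula.atom p).code 0 a.down) = true}

/-- The induction is over all `M` and `D` at once because evaluating `sab` passes to a deleted
model, described by the extended code. Atoms are compared with `D = 0`, as deletions do not affect
the valuation. -/
theorem sat_iff_tVar (hz : ∀ c, ∀ C ∈ clauses P c, ∃ l ∈ C, z l.1 = l.2) (φ : Formula P) :
    ∀ (M : Model P (ULift.{v} ℕ)) (D : ℕ),
      (∀ a b : ℕ, M.R ⟨a⟩ ⟨b⟩ ↔ z (rVar D a b) = true) →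
      (∀ p, M.V p = (modelOf.{u, v} P z).V p) →
      ∀ a : ℕ, φ.Sat M ⟨a⟩ ↔ z (tVar φ.code D a) = true := by
  have h := forall_clauses_iff.1 hz
  simp only [clausesAt, List.forall_mem_cons, List.exists_mem_cons_iff, List.not_mem_nil,
    false_and, exists_false, or_false, ← Bool.not_eq_true] at h
  induction φ with
  | atom p =>
    intro M D hR hV a
    obtain ⟨-, -, -, -, -, -, -, -, -, -, -, -, -, -, h1, h2, -⟩ := h (Encodable.encode p) 0 D a 0
    rw [Formula.Sat, hV]
    change z (tVar (Nat.pair 0 _) 0 a) = true ↔ z (tVar (Nat.pair 0 _) D a) = true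
    tauto
  | neg φ ih =>
    intro M D hR hV a
    obtain ⟨h1, h2, -⟩ := h φ.code 0 D a 0
    rw [Formula.Sat, ih M D hR hV, Formula.code]
    tauto
  | and φ ψ ih₁ ih₂ =>
    intro M D hR hV a
    obtain ⟨-, -, h1, h2, h3, -⟩ := h φ.code ψ.code D a 0
    rw [Formula.Sat, ih₁ M D hR hV, ih₂ M D hR hV, Formula.code]
    tauto
  | box φ ih =>
    intro M D hR hV a
    rw [Formula.Sat, Formula.code]
    constructor
    · intro hb
      obtain ⟨-, -, -, -, -, -, -, -, -, -, -, -, -, h1, -⟩ := h φ.code 0 D a 0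
      refine h1.resolve_right ?_
      rintro ⟨l, hl, hzl⟩
      obtain ⟨b, -, rfl⟩ := List.mem_map.1 hl
      -- With `a` also as the parameter `y`, the clause that deletions add no links speaks of a
      -- deletion at `a` itself.
      obtain ⟨-, -, -, -, -, -, -, h2, h3, -⟩ := h φ.code a D a b
      have h4 := (ih M D hR hV b).1 (hb ⟨b⟩ ((hR a b).2 (h2.resolve_left (not_not.2 hzl))))
      exact (h3.resolve_left (not_not.2 hzl)) h4
    · rintro hb ⟨b⟩ hab
      obtain ⟨-, -, -, -, -, -, -, -, -, h1, -, -, h2, -⟩ := h φ.code a D a b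
      rw [hR] at hab
      rw [ih M D hR hV b]
      tauto
  | sab φ ψ ih₁ ih₂ =>
    intro M D hR hV a
    obtain ⟨-, -, -, -, -, h1, h2, -⟩ := h φ.code ψ.code D a 0
    rw [Formula.Sat, ih₂ (M.delete ⟨a⟩ {w | φ.Sat M w}) (consDel a φ.code D) ?_ hV a, Formula.code]
    · exact ⟨fun ht => h2.resolve_right (not_not.2 ht), fun ht => h1.resolve_left (not_not.2 ht)⟩
    · intro c b
      have hS := ih₁ M D hR hV b
      simp only [Model.delete, Set.mem_ofPred_eq, hR, hS, ULift.up_inj]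
      obtain ⟨-, -, -, -, -, -, -, h3, -⟩ := h φ.code a D c b
      -- Distinct numbers differ by some `k + 1`, and the clauses express distinctness in this way,
      -- one for each order.
      rcases lt_trichotomy c a with hc | rfl | hc
      · obtain ⟨k, rfl⟩ := Nat.exists_eq_add_of_lt hc
        obtain ⟨-, -, -, -, -, -, -, -, -, -, -, h4, -⟩ := h φ.code k D c b
        have : c ≠ c + k + 1 := by omega
        exact ⟨fun hr => h4.resolve_right (not_not.2 hr.1),
          fun hr => ⟨h3.resolve_left (not_not.2 hr), fun ht => this ht.1⟩⟩
      · obtain ⟨-, -, -, -, -, -, -, -, h4, h5, -⟩ := h φ.code c D c b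
        exact ⟨fun hr => by_contra fun hn => hr.2 ⟨by trivial,
            (h5.resolve_left hn).resolve_left (not_not.2 hr.1)⟩,
          fun hr => ⟨h3.resolve_left (not_not.2 hr),
            fun ht => h4.resolve_left (not_not.2 hr) ht.2⟩⟩
      · obtain ⟨k, rfl⟩ := Nat.exists_eq_add_of_lt hc
        obtain ⟨-, -, -, -, -, -, -, -, -, -, h4, -⟩ := h φ.code k D a b
        have : a + k + 1 ≠ a := by omega
        exact ⟨fun hr => h4.resolve_right (not_not.2 hr.1),
          fun hr => ⟨h3.resolve_left (not_not.2 hr), fun ht => this ht.1⟩⟩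

end modelOf

/-! ### Validity as propositional entailment -/

/-- `n` is the code of a validity if and only if the clauses entail that `n` is the code of a
formula that is true at the root. -/
theorem mem_code_image_validities_iff {P : Type u} [Encodable P] [Nonempty P] (n : ℕ) :
    n ∈ Formula.code '' validities.{u, v} P ↔
      ∀ z : ℕ → Bool, (∀ c, ∀ C ∈ clauses P c, ∃ l ∈ C, z l.1 = l.2) →
        ¬ ∃ l ∈ [(fVar n, false), (tVar n 0 0, false)], z l.1 = l.2 := by
  have p₀ : P := Classical.arbitrary P
  simp only [List.exists_mem_cons_iff, List.not_mem_nil, false_and, exists_false, or_false,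
    not_or, Bool.not_eq_false]
  constructor
  · rintro ⟨φ, hφ, rfl⟩ z hz
    refine ⟨fVar_code_of_clauses hz φ, ?_⟩
    rw [← sat_iff_tVar.{u, v} hz φ (modelOf P z) 0 (fun _ _ => Iff.rfl) fun _ => rfl]
    exact hφ _ _ _
  · intro h
    -- Any model serves here: its valuation makes `fVar` true only at codes, so entailment of `fVar
    -- n` forces `n` to be a code.
    obtain ⟨z, hz, -, hf⟩ := exists_valuation p₀ (⟨fun _ _ => False, fun _ => ∅⟩ : Model P ℕ)
      (.atom p₀) 0
    obtain ⟨φ, rfl⟩ := (hf n).1 (h z hz).1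
    refine ⟨φ, fun W _ M w => ?_, rfl⟩
    obtain ⟨z, hz, ht, -⟩ := exists_valuation p₀ M φ w
    exact ht.1 (h z hz).2

theorem isEmpty_formula (P : Type u) [IsEmpty P] : IsEmpty (Formula P) :=
  ⟨fun φ => by
    induction φ with
    | atom p => exact isEmptyElim p
    | _ => assumption⟩

/-- Membership in the set of codes of validities is the projection of a primitive recursive
relation. -/
theorem exists_primrecRel_validities (P : Type u) [Primcodable P] :
    ∃ R : ℕ → ℕ → Prop, PrimrecRel R ∧
      ∀ n, n ∈ Formula.code '' validities.{u, v} P ↔ ∃ m, R n m := by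
  rcases isEmpty_or_nonempty P with hP | hP
  · have hF := isEmpty_formula P
    refine ⟨fun _ _ => False, PrimrecPred.of_eq (p := fun p : ℕ × ℕ => p.1 < 0)
      (Primrec.nat_lt.comp Primrec.fst (Primrec.const 0)) (by simp), fun n => ?_⟩
    simp only [exists_false, iff_false]
    rintro ⟨φ, -⟩
    exact hF.false φ
  · have hq : Primrec fun n : ℕ => [(fVar n, false), (tVar n 0 0, false)] :=
      Primrec.list_cons.comp (Primrec.pair (primrec_fVar Primrec.id) (Primrec.const false))
        (Primrec.list_cons.comp (Primrec.pair (primrec_tVar Primrec.id (Primrec.const 0)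
          (Primrec.const 0)) (Primrec.const false)) (Primrec.const []))
    obtain ⟨R, hR, h⟩ := exists_primrecRel_unsat (primrec_clauses P) hq
    exact ⟨R, hR, fun n => (mem_code_image_validities_iff n).trans (h n).symm⟩

/-! ### Padding and Craig's trick -/

/-- A validity of length growing with `m`. -/
def padding {P : Type u} (p : P) : ℕ → Formula P
  | 0 => (Formula.atom p).imp (.atom p)
  | m + 1 => .box (padding p m)

section padding

variable {P : Type u} (p : P)

theorem padding_mem_validities (m : ℕ) : padding p m ∈ validities.{u, v} P := by
  induction m with
  | zero => exact fun W _ M w h => h.2 h.1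
  | succ m ih => exact fun W _ M w x _ => ih W M x

variable [Primcodable P]

theorem primrec_code_padding : Primrec fun m => (padding p m).code := by
  refine (Primrec.nat_rec₁ (padding p 0).code
    (f := fun _ k => Nat.pair 3 k) (Primrec₂.natPair.comp (Primrec.const 3) Primrec.snd)).of_eq
    fun m => ?_
  induction m with
  | zero => rfl
  | succ m ih => exact congrArg (Nat.pair 3) ih

/-- Each box strictly raises the code. An axiom padded with `m` thus has a code of at least `m`,
which bounds the search for `m`. -/
theorem le_code_padding (m : ℕ) : m ≤ (padding p m).code := by
  induction m with
  | zero => exact Nat.zero_le _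
  | succ m ih => exact ih.trans_lt (lt_pair_succ 2 _)

end padding

/-- The number of `φ → ψ`, computed from the numbers of `φ` and `ψ`. -/
def impCode (x y : ℕ) : ℕ := Nat.pair 1 (Nat.pair 2 (Nat.pair x (Nat.pair 1 y)))

theorem le_impCode_left (x y : ℕ) : x ≤ impCode x y :=
  (Nat.left_le_pair _ _).trans ((Nat.right_le_pair _ _).trans (Nat.right_le_pair _ _))

theorem le_impCode_right (x y : ℕ) : y ≤ impCode x y :=
  (Nat.right_le_pair _ _).trans ((Nat.right_le_pair _ _).trans
    ((Nat.right_le_pair _ _).trans (Nat.right_le_pair _ _)))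

theorem Derivable.mem_validities {P : Type u} {Ax : Set (Formula P)}
    (h : Ax ⊆ validities.{u, v} P) {φ : Formula P} (hφ : Derivable Ax φ) :
    φ ∈ validities.{u, v} P := by
  induction hφ with
  | ax hφ => exact h hφ
  | mp _ _ ih₁ ih₂ => exact fun W _ M w => by_contra fun hn => ih₁ W M w ⟨ih₂ W M w, hn⟩

/-- Craig's trick: a set of validities enumerated by a primitive recursive relation is
axiomatized by a decidable set of padded formulas. -/
theorem recursivelyAxiomatizable_validities (P : Type u) [Primcodable P] [Nonempty P]
    {R : ℕ → ℕ → Prop} (hR : PrimrecRel R)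
    (h : ∀ n, n ∈ Formula.code '' validities.{u, v} P ↔ ∃ m, R n m) :
    RecursivelyAxiomatizable (validities.{u, v} P) := by
  have p : P := Classical.arbitrary P
  have hmem : ∀ φ : Formula P, φ ∈ validities.{u, v} P ↔ ∃ m, R φ.code m := fun φ => by
    rw [← h, Formula.code_injective.mem_set_image]
  -- The padding records the certificate `m` for `ψ`, so deciding whether a formula is an axiom
  -- needs only bounded search, and `ψ` follows by one detachment.
  refine ⟨{φ | (∃ m, φ = padding p m) ∨
    ∃ m ψ, φ = (padding p m).imp ψ ∧ R ψ.code m}, ?_, fun φ => ⟨fun hφ => ?_, ?_⟩⟩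
  · have h1 : PrimrecRel fun m n : ℕ => (padding p m).code = n :=
      Primrec.eq.comp ((primrec_code_padding p).comp Primrec.fst) Primrec.snd
    have h2 : PrimrecRel fun (k : ℕ) (q : ℕ × ℕ) =>
        impCode (padding p q.1).code k = q.2 ∧ R k q.1 :=
      PrimrecPred.and
        (Primrec.eq.comp (Primrec₂.natPair.comp (Primrec.const 1) (Primrec₂.natPair.comp
          (Primrec.const 2) (Primrec₂.natPair.comp
            ((primrec_code_padding p).comp (Primrec.fst.comp Primrec.snd))
            (Primrec₂.natPair.comp (Primrec.const 1) Primrec.fst))))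
          (Primrec.snd.comp Primrec.snd))
        (hR.comp Primrec.fst (Primrec.fst.comp Primrec.snd))
    have h3 : PrimrecRel fun m n : ℕ => ∃ k ∈ List.range (n + 1),
        impCode (padding p m).code k = n ∧ R k m :=
      h2.exists_mem_list.comp (Primrec.list_range.comp (Primrec.succ.comp Primrec.snd))
        (Primrec.pair Primrec.fst Primrec.snd)
    have h4 : PrimrecRel fun m n : ℕ => (padding p m).code = n ∨
        ∃ k ∈ List.range (n + 1), impCode (padding p m).code k = n ∧ R k m := PrimrecPred.or h1 h3
    have h5 : PrimrecPred fun n : ℕ => ∃ m ∈ List.range (n + 1), (padding p m).code = n ∨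
        ∃ k ∈ List.range (n + 1), impCode (padding p m).code k = n ∧ R k m :=
      h4.exists_mem_list.comp (Primrec.list_range.comp Primrec.succ) Primrec.id
    refine ComputablePred.of_eq h5.computablePred fun n => ?_
    simp only [List.mem_range, Nat.lt_succ_iff]
    constructor
    · rintro ⟨m, -, hm | ⟨k, -, hk, hkm⟩⟩
      · exact ⟨_, Or.inl ⟨m, rfl⟩, hm⟩
      · obtain ⟨ψ, -, rfl⟩ := (h k).2 ⟨m, hkm⟩
        exact ⟨_, Or.inr ⟨m, ψ, rfl, hkm⟩, hk⟩
    · rintro ⟨_, ⟨m, rfl⟩ | ⟨m, ψ, rfl, hψ⟩, rfl⟩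
      · exact ⟨m, le_code_padding p m, Or.inl rfl⟩
      · exact ⟨m, (le_code_padding p m).trans (le_impCode_left _ _),
          Or.inr ⟨ψ.code, le_impCode_right _ _, rfl, hψ⟩⟩
  · obtain ⟨m, hm⟩ := (hmem φ).1 hφ
    exact .mp (.ax (Or.inr ⟨m, φ, rfl, hm⟩)) (.ax (Or.inl ⟨m, rfl⟩))
  · refine Derivable.mem_validities ?_
    rintro _ (⟨m, rfl⟩ | ⟨m, ψ, rfl, hψ⟩)
    · exact padding_mem_validities p m
    · exact fun W _ M w hw => hw.2 ((hmem ψ).2 ⟨m, hψ⟩ W M w)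

end SdML

theorem mainTheorem7 (P : Type u) [Primcodable P] :
    SdML.RecursivelyAxiomatizable (SdML.validities.{u, v} P) ∧
      REPred (fun n : ℕ => n ∈ SdML.Formula.code '' SdML.validities.{u, v} P) := by
  obtain ⟨R, hR, h⟩ := SdML.exists_primrecRel_validities.{u, v} P
  refine ⟨?_, (SdML.rePred_exists hR).of_eq fun n => (h n).symm⟩
  rcases isEmpty_or_nonempty P with hP | hP
  · have hF := SdML.isEmpty_formula P
    refine ⟨∅, ComputablePred.of_eq (p := fun n : ℕ => n < 0) ?_ (by simp), fun φ => hF.elim φ⟩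
    exact (Primrec.nat_lt.comp Primrec.id (Primrec.const 0)).computablePred
  · exact SdML.recursivelyAxiomatizable_validities P hR h
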